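/- All groups are abelian. A group $G$ is slender if it is torsion-free and, for every homomorphism $h:\mathbb Z^{\omega}\to G$, $h(e_n)=0$ for all but finitely many $n\in\mathbb N$, where $e_n\in\mathbb Z^\omega$ is the $n$-th standard unit vector. Let $L$ be the vocabulary of groups, consisting of a binary function symbol $+$ and a constant $0$. For infinite cardinals $\lambda\le\kappa$, $L_{\kappa\lambda}$ is the smallest collection of formulas that contains the atomic $L$-formulas and is closed under negation, under conjunctions and disjunctions of fewer than $\kappa$ formulas, and under existential and universal quantifier strings of length less than $\lambda$; $L_{\infty\lambda}$ is the union of the $L_{\kappa\lambda}$ over all infinite $\kappa\ge\lambda$. **Theorem.** There is a single sentence $\Phi$ of $L_{(2^{\aleph_0})^+\,\aleph_1}$ such that for every abelian group $G$, $G$ is slender if and only if $G\models\Phi$. Hence the class of slender abelian groups is axiomatizable in $L_{\infty\omega_1}$: it is the class of all models, among abelian groups, of some sentence of $L_{\infty\omega_1}$. -/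

import Mathlib

universe u u' v w

/-- Formulas of the infinitary logic over a vocabulary `L`, with free variables from `α`.
Conjunctions and disjunctions are taken over arbitrary families of formulas; a quantifier
string `ex ι`, `all ι` binds at once one fresh variable for each element of `ι`. -/
inductive InfFormula (L : FirstOrder.Language.{u, u'}) : Type w → Type (max u u' (w + 1))
  | equal {α : Type w} (t₁ t₂ : L.Term α) : InfFormula L α
  | rel {α : Type w} {n : ℕ} (R : L.Relations n) (ts : Fin n → L.Term α) : InfFormula L α
  | neg {α : Type w} (φ : InfFormula L α) : InfFormula L α
  | conj {α : Type w} (ι : Type w) (φ : ι → InfFormula L α) : InfFormula L α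
  | disj {α : Type w} (ι : Type w) (φ : ι → InfFormula L α) : InfFormula L α
  | ex {α : Type w} (ι : Type w) (φ : InfFormula L (α ⊕ ι)) : InfFormula L α
  | all {α : Type w} (ι : Type w) (φ : InfFormula L (α ⊕ ι)) : InfFormula L α

namespace InfFormula

variable {L : FirstOrder.Language.{u, u'}}

/-- `φ` belongs to `L_{κμ}`: conjunctions and disjunctions of fewer than `κ` formulas,
quantifier strings of length less than `μ`. -/
def InLogic (κ μ : Cardinal.{w}) : {α : Type w} → InfFormula L α → Prop
  | _, .equal _ _ => True
  | _, .rel _ _ => True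
  | _, .neg φ => φ.InLogic κ μ
  | _, .conj ι φ => Cardinal.mk ι < κ ∧ ∀ i, (φ i).InLogic κ μ
  | _, .disj ι φ => Cardinal.mk ι < κ ∧ ∀ i, (φ i).InLogic κ μ
  | _, .ex ι φ => Cardinal.mk ι < μ ∧ φ.InLogic κ μ
  | _, .all ι φ => Cardinal.mk ι < μ ∧ φ.InLogic κ μ

/-- Tarskian truth of a formula in the `L`-structure `M` under an assignment of its free
variables. -/
def Realize (M : Type v) [L.Structure M] : {α : Type w} → InfFormula L α → (α → M) → Prop
  | _, .equal t₁ t₂, s => t₁.realize s = t₂.realize s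
  | _, .rel R ts, s => FirstOrder.Language.Structure.RelMap R fun i => (ts i).realize s
  | _, .neg φ, s => ¬ φ.Realize M s
  | _, .conj _ φ, s => ∀ i, (φ i).Realize M s
  | _, .disj _ φ, s => ∃ i, (φ i).Realize M s
  | _, .ex ι φ, s => ∃ b : ι → M, φ.Realize M (Sum.elim s b)
  | _, .all ι φ, s => ∀ b : ι → M, φ.Realize M (Sum.elim s b)

end InfFormula

/-- Infinitary sentences: formulas without free variables. -/
abbrev InfSentence (L : FirstOrder.Language.{u, u'}) : Type (max u u' (w + 1)) :=
  InfFormula.{u, u', w} L PEmpty.{w + 1}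

/-- The sentence `Φ` holds in the structure `M`. -/
def InfSentence.Holds {L : FirstOrder.Language.{u, u'}} (Φ : InfSentence.{u, u', w} L)
    (M : Type v) [L.Structure M] : Prop :=
  InfFormula.Realize M Φ PEmpty.elim

/-- The function symbols of the vocabulary of groups: a constant `0` and a binary `+`. -/
inductive GroupFunc : ℕ → Type
  | zero : GroupFunc 0
  | add : GroupFunc 2

/-- The vocabulary of (abelian) groups. -/
def groupVocabulary : FirstOrder.Language.{0, 0} where
  Functions := GroupFunc
  Relations := fun _ => Empty

/-- An abelian group as a structure for the vocabulary of groups. -/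
instance groupVocabularyStructure (G : Type v) [AddCommGroup G] :
    groupVocabulary.Structure G where
  funMap := fun {_} f x => match f, x with
    | .zero, _ => 0
    | .add, x => x 0 + x 1
  RelMap := fun {_} R _ => nomatch R

/-- A class `C` of abelian groups is axiomatizable in `L_{∞μ}`: for some sentence of some
`L_{κμ}`, with `κ ≥ μ` infinite, `C` is exactly the class of its models. -/
def IsAxiomatizable (μ : Cardinal.{w}) (C : (G : Type v) → [AddCommGroup G] → Prop) : Prop :=
  ∃ κ : Cardinal.{w}, Cardinal.aleph0 ≤ κ ∧ μ ≤ κ ∧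
    ∃ Φ : InfSentence.{0, 0, w} groupVocabulary, Φ.InLogic κ μ ∧
      ∀ (G : Type v) [AddCommGroup G], C G ↔ Φ.Holds G

/-- An abelian group `G` is slender if it is torsion-free and every homomorphism
`ℤ^ω → G` kills all but finitely many of the standard unit vectors. -/
def IsSlender (G : Type v) [AddCommGroup G] : Prop :=
  IsAddTorsionFree G ∧
    ∀ h : (ℕ → ℤ) →+ G, {n : ℕ | h (Pi.single n 1) ≠ 0}.Finite

/-!
A homomorphism `h : ℤ^ω → G` cannot be quantified over in the logic, but the sequence
`g n = h (e n)` can, and `h` provides a value for each formal series `∑ n! a n g n` in `G`. Such a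
value is expressible: it comes with tails satisfying `y n = a n g n + (n + 1) y (n + 1)`.
Conversely, in a slender group two values of the same series agree: their difference starts a
solution of `y n = (n + 1) y (n + 1)`, which spans a divisible subgroup, and divisible groups are
injective, so a nonzero `y n` would be the image of all the unit vectors under one homomorphism.
Hence if all these series have values, then `a ↦ ∑ n! a n g n` is a homomorphism sending `e n` to
`n! g n`, and almost all `g n` vanish. A group with a nonzero torsion element `x` violates the
resulting criterion through the constant sequence `x`. The sentence needs a conjunction over the
`2 ^ ℵ₀` sequences `a` of natural numbers and countable quantifier strings for `g` and `y`.
-/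

open Filter FirstOrder.Language

section Divisible

variable {D : Type v} [AddCommGroup D] [DivisibleBy D ℤ]

theorem exists_addMonoidHom_single_one_eq {ι : Type w} [DecidableEq ι] (d : ι → D) :
    ∃ h : (ι → ℤ) →+ D, ∀ i, h (Pi.single i 1) = d i := by
  obtain ⟨h, hh⟩ := (Module.Baer.of_divisible D).extension_property_addMonoidHom
    (Finsupp.coeFnAddHom : (ι →₀ ℤ) →+ ι → ℤ) DFunLike.coe_injective
    (Finsupp.linearCombination ℤ d).toAddMonoidHom
  refine ⟨h, fun i => ?_⟩
  rw [← Finsupp.single_eq_pi_single]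
  exact (DFunLike.congr_fun hh (Finsupp.single i 1)).trans (by simp)

theorem IsSlender.map_eq_zero_of_divisibleBy {G : Type w} [AddCommGroup G] (hG : IsSlender G)
    (f : D →+ G) (d : D) : f d = 0 := by
  obtain ⟨h, hh⟩ := exists_addMonoidHom_single_one_eq fun _ : ℕ => d
  obtain ⟨n, hn⟩ := (hG.2 (f.comp h)).exists_notMem
  simpa [hh] using hn

end Divisible

/-- The sequence `y` consists of tails of the formal series `∑ n! • c n`, each divided by its
leading factorial: `y n` stands for `∑ k ≥ n, (k! / n!) • c k`, and `y 0` for the whole series.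
The recursion makes sense in any group, without a notion of convergence. -/
def IsFactorialTail {M : Type v} [AddCommMonoid M] (c y : ℕ → M) : Prop :=
  ∀ n, y n = c n + (n + 1) • y (n + 1)

namespace IsFactorialTail

section AddCommMonoid

variable {M : Type v} [AddCommMonoid M] {c d y z : ℕ → M}

theorem add (hy : IsFactorialTail c y) (hz : IsFactorialTail d z) :
    IsFactorialTail (c + d) (y + z) := fun n => by
  simp only [Pi.add_apply, smul_add, hy n, hz n]
  abel

theorem map {N : Type w} [AddCommMonoid N] (f : M →+ N) (hy : IsFactorialTail c y) :
    IsFactorialTail (f ∘ c) (f ∘ y) := fun n => by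
  simp only [Function.comp_apply, ← map_nsmul, ← map_add, ← hy n]

theorem single (k : ℕ) (x : M) :
    IsFactorialTail (Pi.single k x)
      (fun n => if n ≤ k then k.descFactorial (k - n) • x else 0) := fun n => by
  rcases lt_trichotomy n k with h | rfl | h
  · have step : k.descFactorial (k - n) = (n + 1) * k.descFactorial (k - (n + 1)) := by
      rw [show k - n = k - (n + 1) + 1 by omega, Nat.descFactorial_succ]
      congr 1
      omega
    simp [h.ne, h.le, Nat.succ_le_of_lt h, step, mul_smul]
  · simp
  · simp [h.ne', h.not_ge, (h.trans n.lt_succ_self).not_ge]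

theorem pi_single (c : ℕ → M) :
    IsFactorialTail (fun n => (Pi.single n (c n) : ℕ → M))
      (fun n k => if n ≤ k then k.descFactorial (k - n) • c k else 0) := fun n => by
  ext k
  refine (single k (c k) n).trans ?_
  rcases eq_or_ne n k with rfl | h
  · simp
  · simp [h, h.symm]

theorem eq_ascFactorial_nsmul (hy : IsFactorialTail 0 y) (n m : ℕ) :
    y n = (n + 1).ascFactorial m • y (n + m) := by
  induction m with
  | zero => simp
  | succ m ih =>
    rw [ih, hy (n + m), Pi.zero_apply, zero_add, smul_smul, Nat.ascFactorial_succ,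
      mul_comm, ← add_assoc n m 1, Nat.add_right_comm n 1 m]

end AddCommMonoid

section AddCommGroup

variable {G : Type v} [AddCommGroup G] {c d y z : ℕ → G}

theorem sub (hy : IsFactorialTail c y) (hz : IsFactorialTail d z) :
    IsFactorialTail (c - d) (y - z) := fun n => by
  simp only [Pi.sub_apply, smul_sub, hy n, hz n]
  abel

theorem exists_nsmul_eq_of_mem_closure (hy : IsFactorialTail 0 y) {m : ℕ} (hm : m ≠ 0)
    {x : G} (hx : x ∈ AddSubgroup.closure (Set.range y)) :
    ∃ z ∈ AddSubgroup.closure (Set.range y), m • z = x := by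
  suffices h : AddSubgroup.closure (Set.range y) ≤
      (AddSubgroup.closure (Set.range y)).map (nsmulAddMonoidHom m) from h hx
  rw [AddSubgroup.closure_le]
  rintro _ ⟨n, rfl⟩
  obtain ⟨q, hq⟩ := (Nat.dvd_factorial (Nat.pos_of_ne_zero hm) le_rfl).trans
    ((n + 1).factorial_dvd_ascFactorial m)
  refine ⟨q • y (n + m), nsmul_mem (AddSubgroup.subset_closure (Set.mem_range_self _)) q, ?_⟩
  rw [hy.eq_ascFactorial_nsmul n m, hq, mul_smul, nsmulAddMonoidHom_apply]

end AddCommGroup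

end IsFactorialTail

theorem exists_isFactorialTail_of_nsmul_eq_zero {M : Type v} [AddCommMonoid M] {c : ℕ → M}
    {m : ℕ} (hm : m ≠ 0) (hc : ∀ n, m • c n = 0) :
    ∃ y, IsFactorialTail c y := by
  refine ⟨fun n => ∑ j ∈ Finset.range m, (n + 1).ascFactorial j • c (n + j), fun n => ?_⟩
  have last : (n + 1).ascFactorial m • c (n + m) = 0 := by
    obtain ⟨q, hq⟩ := (Nat.dvd_factorial (Nat.pos_of_ne_zero hm) le_rfl).trans
      ((n + 1).factorial_dvd_ascFactorial m)
    rw [hq, mul_comm, mul_smul, hc, smul_zero]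
  have shift (j : ℕ) : (n + 1) • (n + 1 + 1).ascFactorial j • c (n + 1 + j) =
      (n + 1).ascFactorial (j + 1) • c (n + (j + 1)) := by
    rw [smul_smul, Nat.succ_ascFactorial, ← Nat.ascFactorial_succ, Nat.add_assoc n 1 j,
      Nat.add_comm 1 j]
  calc ∑ j ∈ Finset.range m, (n + 1).ascFactorial j • c (n + j)
      = ∑ j ∈ Finset.range (m + 1), (n + 1).ascFactorial j • c (n + j) := by
        rw [Finset.sum_range_succ, last, add_zero]
    _ = c n + (n + 1) • ∑ j ∈ Finset.range m, (n + 1 + 1).ascFactorial j • c (n + 1 + j) := by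
        simp only [Finset.sum_range_succ', Finset.smul_sum, shift]
        simp [add_comm]

theorem exists_isFactorialTail_zsmul {G : Type v} [AddCommGroup G] {g : ℕ → G}
    (hg : ∀ a : ℕ → ℕ, ∃ y, IsFactorialTail (fun n => a n • g n) y) (a : ℕ → ℤ) :
    ∃ y, IsFactorialTail (fun n => a n • g n) y := by
  obtain ⟨y, hy⟩ := hg fun n => (a n).toNat
  obtain ⟨z, hz⟩ := hg fun n => (-a n).toNat
  refine ⟨y - z, ?_⟩
  convert hy.sub hz using 1
  ext n
  rw [Pi.sub_apply, ← natCast_zsmul, ← natCast_zsmul, ← sub_smul, Int.toNat_sub_toNat_neg]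

section Slender

variable {G : Type v} [AddCommGroup G]

theorem IsSlender.eq_zero_of_isFactorialTail_zero (hG : IsSlender G) {y : ℕ → G}
    (hy : IsFactorialTail 0 y) (n : ℕ) : y n = 0 := by
  let D := AddSubgroup.closure (Set.range y)
  let : DivisibleBy D ℕ := divisibleByOfSMulRightSurj _ _ fun {m} hm ⟨x, hx⟩ => by
    obtain ⟨z, hz, rfl⟩ := hy.exists_nsmul_eq_of_mem_closure hm hx
    exact ⟨⟨z, hz⟩, rfl⟩
  let : DivisibleBy D ℤ := AddGroup.divisibleByIntOfDivisibleByNat D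
  exact hG.map_eq_zero_of_divisibleBy D.subtype
    ⟨y n, AddSubgroup.subset_closure (Set.mem_range_self n)⟩

theorem exists_addMonoidHom_single_one_eq_factorial_nsmul
    (hred : ∀ y : ℕ → G, IsFactorialTail 0 y → y 0 = 0) {g : ℕ → G}
    (hg : ∀ a : ℕ → ℤ, ∃ y, IsFactorialTail (fun n => a n • g n) y) :
    ∃ h : (ℕ → ℤ) →+ G, ∀ n, h (Pi.single n 1) = n.factorial • g n := by
  have unique {c y z : ℕ → G} (hy : IsFactorialTail c y) (hz : IsFactorialTail c z) :
      y 0 = z 0 :=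
    sub_eq_zero.1 (hred (y - z) (by simpa using hy.sub hz))
  choose σ hσ using hg
  refine ⟨AddMonoidHom.mk' (fun a => σ a 0) fun a b => unique (z := σ a + σ b) (hσ (a + b)) ?_,
    fun k => ?_⟩
  · convert (hσ a).add (hσ b) using 1
    ext n
    exact add_smul (a n) (b n) (g n)
  · have hk : (fun n => (Pi.single k 1 : ℕ → ℤ) n • g n) = Pi.single k (g k) := by
      ext n
      rcases eq_or_ne n k with rfl | h <;> simp [*]
    have tail := hσ (Pi.single k 1)
    rw [hk] at tail
    simpa [Nat.descFactorial_self] using unique tail (IsFactorialTail.single k (g k))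

theorem exists_isFactorialTail_nsmul_map_single (h : (ℕ → ℤ) →+ G) (a : ℕ → ℕ) :
    ∃ y, IsFactorialTail (fun n => a n • h (Pi.single n 1)) y := by
  have tail := (IsFactorialTail.pi_single fun n => (a n : ℤ)).map h
  have coeff : h ∘ (fun n => Pi.single n (a n : ℤ)) = fun n => a n • h (Pi.single n 1) := by
    ext n
    rw [Function.comp_apply, ← map_nsmul, ← Pi.single_smul, nsmul_one]
  exact ⟨_, coeff ▸ tail⟩

theorem isSlender_iff_eventually_eq_zero :
    IsSlender G ↔ ∀ g : ℕ → G,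
      (∀ a : ℕ → ℕ, ∃ y, IsFactorialTail (fun n => a n • g n) y) → ∀ᶠ n in atTop, g n = 0 := by
  constructor
  · intro hG g hg
    have := hG.1
    obtain ⟨h, hh⟩ := exists_addMonoidHom_single_one_eq_factorial_nsmul
      (fun _ hy => hG.eq_zero_of_isFactorialTail_zero hy 0) (exists_isFactorialTail_zsmul hg)
    have hfin : ∀ᶠ n in cofinite, h (Pi.single n 1) = 0 := hG.2 h
    rw [Nat.cofinite_eq_atTop] at hfin
    filter_upwards [hfin] with n hn
    rwa [hh, nsmul_eq_zero_iff_right n.factorial_ne_zero] at hn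
  · intro hG
    refine ⟨⟨fun m hm x y hxy => ?_⟩, fun h => ?_⟩
    · have torsion : m • (x - y) = 0 := by simpa [smul_sub, sub_eq_zero] using hxy
      -- The factorial series of a constant torsion sequence are finite sums.
      have tails (a : ℕ → ℕ) : ∃ z, IsFactorialTail (fun n => a n • (x - y)) z :=
        exists_isFactorialTail_of_nsmul_eq_zero hm fun n => by rw [smul_comm, torsion, smul_zero]
      obtain ⟨_, hxy₀⟩ := (hG (fun _ => x - y) tails).exists
      exact sub_eq_zero.1 hxy₀
    · have hfin := hG _ (exists_isFactorialTail_nsmul_map_single h)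
      rwa [← Nat.cofinite_eq_atTop] at hfin

end Slender

namespace InfFormula

section Implication

variable {L : FirstOrder.Language.{u, u'}} {α : Type w} {φ ψ : InfFormula L α}

/-- The implication `φ → ψ`, as the disjunction of `¬ φ` and `ψ`. -/
def imp (φ ψ : InfFormula L α) : InfFormula L α :=
  .disj (ULift Bool) fun b => cond b.down φ.neg ψ

theorem realize_imp {M : Type v} [L.Structure M] {s : α → M} :
    (φ.imp ψ).Realize M s ↔ (φ.Realize M s → ψ.Realize M s) := by
  simp [imp, Realize, or_comm, imp_iff_not_or]

theorem InLogic.imp {κ μ : Cardinal.{w}} (hκ : Cardinal.aleph0 ≤ κ) (hφ : φ.InLogic κ μ)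
    (hψ : ψ.InLogic κ μ) : (φ.imp ψ).InLogic κ μ :=
  ⟨(Cardinal.lt_aleph0_of_finite _).trans_le hκ, by rintro ⟨_ | _⟩ <;> assumption⟩

end Implication

end InfFormula

namespace groupVocabulary

section Terms

variable {α : Type w}

instance : Zero (groupVocabulary.Term α) where
  zero := Constants.term (L := groupVocabulary) GroupFunc.zero

instance : Add (groupVocabulary.Term α) where
  add := Functions.apply₂ (L := groupVocabulary) GroupFunc.add

instance : SMul ℕ (groupVocabulary.Term α) where
  smul := nsmulRec

variable {G : Type v} [AddCommGroup G] (s : α → G)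

theorem realize_zero : (0 : groupVocabulary.Term α).realize s = 0 := rfl

theorem realize_add (t₁ t₂ : groupVocabulary.Term α) :
    (t₁ + t₂).realize s = t₁.realize s + t₂.realize s := rfl

theorem realize_nsmul (n : ℕ) (t : groupVocabulary.Term α) :
    (n • t).realize s = n • t.realize s := by
  induction n with
  | zero => rw [zero_nsmul]; rfl
  | succ n ih => rw [succ_nsmul, ← ih]; rfl

end Terms

/-- The criterion `isSlender_iff_eventually_eq_zero` as a sentence: the outer quantifier string
binds the sequence `g`, the inner one the sequence `y` of tails. The terms `gInner n` are the
variables `g n` in the scope of the inner string. -/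
def slenderSentence : InfSentence.{0, 0, 0} groupVocabulary :=
  let g (n : ℕ) : groupVocabulary.Term (PEmpty ⊕ ℕ) := .var (.inr n)
  let gInner (n : ℕ) : groupVocabulary.Term ((PEmpty ⊕ ℕ) ⊕ ℕ) := .var (.inl (.inr n))
  let y (n : ℕ) : groupVocabulary.Term ((PEmpty ⊕ ℕ) ⊕ ℕ) := .var (.inr n)
  .all ℕ <| .imp
    (.conj (ℕ → ℕ) fun a => .ex ℕ <| .conj ℕ fun n =>
      .equal (y n) (a n • gInner n + (n + 1) • y (n + 1)))
    (.disj ℕ fun N => .conj (Set.Ici N) fun n => .equal (g n) 0)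

theorem slenderSentence_inLogic {κ μ : Cardinal.{0}} (hκ : Cardinal.continuum < κ)
    (hμ : Cardinal.aleph0 < μ) : slenderSentence.InLogic κ μ := by
  have hκ₀ : Cardinal.aleph0 < κ := Cardinal.aleph0_lt_continuum.trans hκ
  have nat_lt_index : Cardinal.mk ℕ < κ := by rwa [Cardinal.mk_nat]
  have nat_lt_length : Cardinal.mk ℕ < μ := by rwa [Cardinal.mk_nat]
  have seq_lt_index : Cardinal.mk (ℕ → ℕ) < κ := by simpa using hκ
  exact ⟨nat_lt_length, .imp hκ₀.le
    ⟨seq_lt_index, fun _ => ⟨nat_lt_length, nat_lt_index, fun _ => trivial⟩⟩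
    ⟨nat_lt_index, fun N => ⟨Cardinal.mk_le_aleph0.trans_lt hκ₀, fun _ => trivial⟩⟩⟩

theorem holds_slenderSentence_iff (G : Type v) [AddCommGroup G] :
    slenderSentence.Holds G ↔ IsSlender G := by
  rw [isSlender_iff_eventually_eq_zero]
  simp only [IsFactorialTail, eventually_atTop, InfSentence.Holds, slenderSentence,
    InfFormula.Realize, InfFormula.realize_imp, realize_zero, realize_add, realize_nsmul,
    Term.realize_var, Sum.elim_inl, Sum.elim_inr, Subtype.forall, Set.mem_Ici]

end groupVocabulary

theorem theorem1p8 :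
    (∃ Φ : InfSentence.{0, 0, 0} groupVocabulary,
      Φ.InLogic (Order.succ ((2 : Cardinal.{0}) ^ Cardinal.aleph0)) (Cardinal.aleph 1) ∧
        ∀ (G : Type v) [AddCommGroup G], IsSlender G ↔ Φ.Holds G) ∧
      IsAxiomatizable.{v, 0} (Cardinal.aleph 1) (fun (G : Type v) [AddCommGroup G] => IsSlender G) := by
  have hΦ : groupVocabulary.slenderSentence.InLogic
      (Order.succ ((2 : Cardinal.{0}) ^ Cardinal.aleph0)) (Cardinal.aleph 1) :=
    groupVocabulary.slenderSentence_inLogic (Order.lt_succ _) Cardinal.aleph0_lt_aleph_one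
  have holds_iff (G : Type v) [AddCommGroup G] :
      IsSlender G ↔ groupVocabulary.slenderSentence.Holds G :=
    (groupVocabulary.holds_slenderSentence_iff G).symm
  have aleph0_lt : Cardinal.aleph0 < (2 : Cardinal.{0}) ^ Cardinal.aleph0 := Cardinal.cantor _
  have aleph_one_le : Cardinal.aleph 1 ≤ Order.succ ((2 : Cardinal.{0}) ^ Cardinal.aleph0) := by
    rw [← Cardinal.succ_aleph0]
    exact Order.succ_le_succ aleph0_lt.le
  exact ⟨⟨_, hΦ, holds_iff⟩, _, aleph0_lt.le.trans (Order.le_succ _), aleph_one_le,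
    _, hΦ, holds_iff⟩
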